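/- Throughout, $R$ is a commutative Noetherian local ring with maximal ideal $\mathfrak m$, and all $R$-modules are finitely generated. Write $X^*=\operatorname{Hom}_R(X,R)$, and let $\Omega^nN$ denote the $n$-th syzygy of $N$ in a minimal free resolution. An $R$-module $X$ is *totally reflexive* if the canonical map $X\to X^{**}$ is an isomorphism and $\operatorname{Ext}^i_R(X,R)=0=\operatorname{Ext}^i_R(X^*,R)$ for all $i\ge 1$. The *Gorenstein dimension* $\operatorname{G-dim}_R(N)$ of a nonzero module $N$ is the infimum of the integers $n\ge 0$ for which there is an exact sequence $0\to X_n\to\cdots\to X_0\to N\to 0$ with every $X_i$ totally reflexive (and $\infty$ if there is none); $\operatorname{G-dim}_R(0)=-\infty$. Let $\operatorname{H}$ be either the projective dimension $\operatorname{pd}_R$ or the Gorenstein dimension $\operatorname{G-dim}_R$. A *reducing $\operatorname{H}$-sequence* of a module $M$ is a sequence of modules $K_0,\dots,K_r$ ($r\ge 0$) with $K_0=M$ and $\operatorname{H}(K_r)<\infty$ such that for each $i=1,\dots,r$ there are positive integers $a_i,b_i,n_i$ and a short exact sequence $$0\to K_{i-1}^{\oplus a_i}\to K_i\to (\Omega^{n_i}K_{i-1})^{\oplus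 b_i}\to 0 .$$ The *reducing projective dimension* $\operatorname{red-pd}_R(M)$ and the *reducing Gorenstein dimension* $\operatorname{red-G-dim}_R(M)$ are the infimum of all $r\ge 0$ for which $M$ has a reducing $\operatorname{pd}_R$-sequence, respectively a reducing $\operatorname{G-dim}_R$-sequence, $K_0,\dots,K_r$ (and $\infty$ if there is none). **Proposition 2.6.** Let $M$ be an $R$-module such that $\operatorname{Ext}^i_R(X,M)=0$ for all $i\ge 1$ and all totally reflexive $R$-modules $X$. Then $$\operatorname{red-G-dim}_R(M)=\operatorname{red-pd}_R(M)$$ (as elements of $\{0,1,2,\dots\}\cup\{\infty\}$; in particular one is finite if and only if the other is). -/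

import Mathlib

open CategoryTheory

universe u

namespace ReducingDimension

/-- A totally reflexive module: `X` is finitely generated, the canonical map `X → X^**` is
bijective, and `Ext^i(X, R) = 0 = Ext^i(X^*, R)` for all `i ≥ 1`. -/
structure IsTotallyReflexive {R : Type u} [CommRing R] (X : ModuleCat.{u} R) : Prop where
  finite : Module.Finite R X
  reflexive : Module.IsReflexive R X
  ext_eq_zero : ∀ i : ℕ, 1 ≤ i → Subsingleton (Abelian.Ext X (ModuleCat.of R R) i)
  ext_dual_eq_zero : ∀ i : ℕ, 1 ≤ i →
    Subsingleton (Abelian.Ext (ModuleCat.of R (Module.Dual R X)) (ModuleCat.of R R) i)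

/-- `HasGResolution n M`: there is an exact sequence `0 → X_n → ⋯ → X_0 → M → 0` in which every
`X_i` is totally reflexive. The sequence is built up from the short exact sequences
`0 → N → X_0 → M → 0` and `0 → X_n → ⋯ → X_1 → N → 0`; for `n = 0` it amounts to an isomorphism
`X_0 ≅ M`. -/
inductive HasGResolution {R : Type u} [CommRing R] : ℕ → ModuleCat.{u} R → Prop
  | zero (X M : ModuleCat.{u} R) (hX : IsTotallyReflexive X) (e : X ≃ₗ[R] M) :
      HasGResolution 0 M
  | succ (n : ℕ) (N X M : ModuleCat.{u} R) (f : N →ₗ[R] X) (g : X →ₗ[R] M)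
      (hf : Function.Injective f) (hfg : Function.Exact f g) (hg : Function.Surjective g)
      (hX : IsTotallyReflexive X) (hN : HasGResolution n N) : HasGResolution (n + 1) M

open Classical in
/-- The Gorenstein dimension of `M`: it is `⊥` (that is, `-∞`) for `M = 0`, otherwise the infimum
of the lengths of resolutions of `M` by totally reflexive modules, and `⊤` (that is, `∞`) if there
is no such resolution. -/
noncomputable def gorensteinDimension {R : Type u} [CommRing R] (M : ModuleCat.{u} R) :
    WithBot ℕ∞ :=
  if Subsingleton M then ⊥ else sInf {d | ∃ n : ℕ, HasGResolution n M ∧ d = ((n : ℕ∞) : WithBot ℕ∞)}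

/-- `IsSyzygy n M N`: `N` is (isomorphic to) the `n`-th syzygy `Ω^n M` of `M` in a minimal
free resolution, over a local ring with maximal ideal `𝔪`. Here `Ω^0 M = M`, and
`Ω^(n+1) M = Ω^n (Ω M)`, where `0 → Ω M → R^k → M → 0` is exact with image of `Ω M` inside
`𝔪 R^k`. This determines `Ω^n M` up to isomorphism. -/
inductive IsSyzygy {R : Type u} [CommRing R] [IsLocalRing R] :
    ℕ → ModuleCat.{u} R → ModuleCat.{u} R → Prop
  | zero (M N : ModuleCat.{u} R) (e : M ≃ₗ[R] N) : IsSyzygy 0 M N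
  | succ (n k : ℕ) (M L N : ModuleCat.{u} R) (f : L →ₗ[R] (Fin k → R)) (g : (Fin k → R) →ₗ[R] M)
      (hf : Function.Injective f) (hfg : Function.Exact f g) (hg : Function.Surjective g)
      (hmin : LinearMap.range f ≤ IsLocalRing.maximalIdeal R • (⊤ : Submodule R (Fin k → R)))
      (hN : IsSyzygy n L N) : IsSyzygy (n + 1) M N

/-- `K_0, …, K_r` is a reducing `H`-sequence of `M`: `K_0 = M`, `H(K_r) < ∞`, and for each
`i < r` there are positive integers `a, b, n` and a short exact sequence
`0 → K_i^{⊕a} → K_{i+1} → (Ω^n K_i)^{⊕b} → 0`. -/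
structure IsReducingSequence {R : Type u} [CommRing R] [IsLocalRing R]
    (H : ModuleCat.{u} R → WithBot ℕ∞) (M : ModuleCat.{u} R) (r : ℕ)
    (K : Fin (r + 1) → ModuleCat.{u} R) : Prop where
  head : K 0 = M
  step : ∀ i : Fin r, ∃ a b n : ℕ, 1 ≤ a ∧ 1 ≤ b ∧ 1 ≤ n ∧
    ∃ S : ModuleCat.{u} R, IsSyzygy n (K i.castSucc) S ∧
      ∃ (f : (Fin a → K i.castSucc) →ₗ[R] K i.succ) (g : K i.succ →ₗ[R] (Fin b → S)),
        Function.Injective f ∧ Function.Exact f g ∧ Function.Surjective g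
  last : H (K (Fin.last r)) < ⊤

/-- The reducing invariant of `H`: the infimum of all `r` for which `M` has a reducing
`H`-sequence `K_0, …, K_r`; it is `⊤` (that is, `∞`) if there is none. -/
noncomputable def reducingInvariant {R : Type u} [CommRing R] [IsLocalRing R]
    (H : ModuleCat.{u} R → WithBot ℕ∞) (M : ModuleCat.{u} R) : ℕ∞ :=
  sInf {d | ∃ (r : ℕ) (K : Fin (r + 1) → ModuleCat.{u} R),
    IsReducingSequence H M r K ∧ d = (r : ℕ∞)}

/-- The reducing Gorenstein dimension. -/
noncomputable def reducingGdim {R : Type u} [CommRing R] [IsLocalRing R]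
    (M : ModuleCat.{u} R) : ℕ∞ :=
  reducingInvariant gorensteinDimension M

/-- The reducing projective dimension. -/
noncomputable def reducingPdim {R : Type u} [CommRing R] [IsLocalRing R]
    (M : ModuleCat.{u} R) : ℕ∞ :=
  reducingInvariant (fun N => projectiveDimension N) M

end ReducingDimension

/-!
The bound `red-G-dim M ≤ red-pd M` holds because a finitely generated module of finite projective
dimension has a finite resolution by finitely generated projective modules, which are totally
reflexive; so every reducing `pd`-sequence is a reducing `G-dim`-sequence.

For the converse, consider the class of modules `K` with `Ext^i(X, K) = 0` for all `i ≥ 1` and all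
totally reflexive `X` (`IsRightOrthogonal`). It contains `M`, and it is closed under finite direct
sums, extensions and syzygies. For syzygies, the vanishing of `Ext^1` rests on the fact that a
totally reflexive `X` sits in a short exact sequence `0 → X → F → Y → 0` with `F` free and `Y`
totally reflexive (`IsTotallyReflexive.exists_cosyzygy`), which gives
`Ext^1(X, Ω K) ≅ Ext^2(Y, Ω K)`. Hence every term of a reducing sequence of `M` lies in this class.
The last term `K_r` has finite Gorenstein dimension, so there is a short exact sequence
`0 → K_r → P → X → 0` with `P` of finite projective dimension and `X` totally reflexive
(`HasGResolution.exists_hull`). It splits because `Ext^1(X, K_r) = 0`, and therefore `K_r` has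
finite projective dimension: the same sequence `K_0, …, K_r` is a reducing `pd`-sequence.
-/

namespace ReducingDimension

/-! ### Short exact sequences and long exact sequences of `Ext` -/

variable {R : Type u} [CommRing R]

/-- The sequence `0 → A → B → C → 0` given by linear maps `f` and `g` is exact. -/
structure IsShortExact {A B C : Type u} [AddCommGroup A] [AddCommGroup B] [AddCommGroup C]
    [Module R A] [Module R B] [Module R C] (f : A →ₗ[R] B) (g : B →ₗ[R] C) : Prop where
  injective : Function.Injective f
  exact : Function.Exact f g
  surjective : Function.Surjective g

namespace IsShortExact

section Ext

variable {A B C : ModuleCat.{u} R} {f : A →ₗ[R] B} {g : B →ₗ[R] C}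

theorem shortExact (h : IsShortExact f g) :
    (ModuleCat.shortComplexOfCompEqZero f g h.exact.linearMap_comp_eq_zero).ShortExact :=
  ModuleCat.shortComplex_shortExact _ h.exact h.injective h.surjective

theorem subsingleton_ext_middle (h : IsShortExact f g) (X : ModuleCat.{u} R) (i : ℕ)
    (hA : Subsingleton (Abelian.Ext X A i)) (hC : Subsingleton (Abelian.Ext X C i)) :
    Subsingleton (Abelian.Ext X B i) := by
  refine subsingleton_of_forall_eq 0 fun x => ?_
  obtain ⟨y, rfl⟩ := Abelian.Ext.covariant_sequence_exact₂ X h.shortExact x (hC.elim _ _)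
  rw [hA.elim y 0, Abelian.Ext.zero_comp]

theorem subsingleton_ext_left (h : IsShortExact f g) (X : ModuleCat.{u} R) (i : ℕ)
    (hC : Subsingleton (Abelian.Ext X C i)) (hB : Subsingleton (Abelian.Ext X B (i + 1))) :
    Subsingleton (Abelian.Ext X A (i + 1)) := by
  refine subsingleton_of_forall_eq 0 fun x => ?_
  obtain ⟨y, rfl⟩ := Abelian.Ext.covariant_sequence_exact₁ X h.shortExact x (hB.elim _ _) rfl
  rw [hC.elim y 0, Abelian.Ext.zero_comp]

theorem subsingleton_ext_middle_contravariant (h : IsShortExact f g) (Y : ModuleCat.{u} R)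
    (i : ℕ) (hA : Subsingleton (Abelian.Ext A Y i)) (hC : Subsingleton (Abelian.Ext C Y i)) :
    Subsingleton (Abelian.Ext B Y i) := by
  refine subsingleton_of_forall_eq 0 fun x => ?_
  obtain ⟨y, rfl⟩ := Abelian.Ext.contravariant_sequence_exact₂ h.shortExact Y x (hA.elim _ _)
  rw [hC.elim y 0, Abelian.Ext.comp_zero]

theorem subsingleton_ext_left_contravariant (h : IsShortExact f g) (Y : ModuleCat.{u} R)
    (i : ℕ) (hB : Subsingleton (Abelian.Ext B Y i))
    (hC : Subsingleton (Abelian.Ext C Y (i + 1))) : Subsingleton (Abelian.Ext A Y i) := by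
  refine subsingleton_of_forall_eq 0 fun x => ?_
  obtain ⟨y, rfl⟩ := Abelian.Ext.contravariant_sequence_exact₁ h.shortExact Y x
    (add_comm 1 i) (hC.elim _ _)
  rw [hB.elim y 0, Abelian.Ext.comp_zero]

theorem subsingleton_ext_right_contravariant (h : IsShortExact f g) (Y : ModuleCat.{u} R)
    (i : ℕ) (hA : Subsingleton (Abelian.Ext A Y i))
    (hB : Subsingleton (Abelian.Ext B Y (i + 1))) : Subsingleton (Abelian.Ext C Y (i + 1)) := by
  refine subsingleton_of_forall_eq 0 fun x => ?_
  obtain ⟨y, rfl⟩ := Abelian.Ext.contravariant_sequence_exact₃ h.shortExact Y x (hB.elim _ _)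
    (add_comm 1 i)
  rw [hA.elim y 0, Abelian.Ext.comp_zero]

/-- If every map `A → Y` extends to `B`, then `Ext¹(C, Y)` embeds into `Ext¹(B, Y)`. -/
theorem subsingleton_ext_one_right (h : IsShortExact f g) (Y : ModuleCat.{u} R)
    (hf : ∀ φ : A →ₗ[R] Y, ∃ ψ : B →ₗ[R] Y, ψ ∘ₗ f = φ)
    (hB : Subsingleton (Abelian.Ext B Y 1)) : Subsingleton (Abelian.Ext C Y 1) := by
  refine subsingleton_of_forall_eq 0 fun x => ?_
  obtain ⟨y, rfl⟩ := Abelian.Ext.contravariant_sequence_exact₃ h.shortExact Y x (hB.elim _ _)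
    (add_comm 1 0)
  obtain ⟨φ, rfl⟩ := Abelian.Ext.mk₀_bijective A Y |>.2 y
  obtain ⟨ψ, hψ⟩ := hf φ.hom
  obtain rfl : ModuleCat.ofHom f ≫ ModuleCat.ofHom ψ = φ := ModuleCat.hom_ext hψ
  rw [← Abelian.Ext.mk₀_comp_mk₀]
  exact h.shortExact.extClass_comp_assoc _

theorem exists_extension (h : IsShortExact f g) (Y : ModuleCat.{u} R)
    (hC : Subsingleton (Abelian.Ext C Y 1)) (φ : A →ₗ[R] Y) :
    ∃ ψ : B →ₗ[R] Y, ψ ∘ₗ f = φ := by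
  obtain ⟨y, hy⟩ := Abelian.Ext.contravariant_sequence_exact₁ h.shortExact Y
    (Abelian.Ext.mk₀ (ModuleCat.ofHom φ)) (add_comm 1 0) (hC.elim _ _)
  obtain ⟨ψ, rfl⟩ := Abelian.Ext.mk₀_bijective B Y |>.2 y
  rw [Abelian.Ext.mk₀_comp_mk₀] at hy
  have := (Abelian.Ext.mk₀_bijective A Y).1 hy
  exact ⟨ψ.hom, congrArg ModuleCat.Hom.hom this⟩

end Ext

section Linear

variable {A B C : Type u} [AddCommGroup A] [AddCommGroup B] [AddCommGroup C]
  [Module R A] [Module R B] [Module R C] {f : A →ₗ[R] B} {g : B →ₗ[R] C}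

theorem of_ker (hg : Function.Surjective g) : IsShortExact (LinearMap.ker g).subtype g :=
  ⟨Subtype.val_injective, LinearMap.exact_subtype_ker_map g, hg⟩

theorem of_range (hf : Function.Injective f) : IsShortExact f (LinearMap.range f).mkQ :=
  ⟨hf, LinearMap.exact_map_mkQ_range f, Submodule.mkQ_surjective _⟩

theorem comp_linearEquiv (h : IsShortExact f g) {A' : Type u} [AddCommGroup A'] [Module R A']
    (e : A' ≃ₗ[R] A) : IsShortExact (f ∘ₗ e.toLinearMap) g :=
  ⟨h.injective.comp e.injective, LinearEquiv.precomp_exact_iff_exact.2 h.exact, h.surjective⟩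

variable {A' B' C' : Type u} [AddCommGroup A'] [AddCommGroup B'] [AddCommGroup C']
  [Module R A'] [Module R B'] [Module R C'] {f' : A' →ₗ[R] B'} {g' : B' →ₗ[R] C'}

theorem bijective_middle (h : IsShortExact f g) (h' : IsShortExact f' g')
    (α : A →ₗ[R] A') (β : B →ₗ[R] B') (γ : C →ₗ[R] C')
    (hαβ : ∀ a, f' (α a) = β (f a)) (hβγ : ∀ b, g' (β b) = γ (g b))
    (hα : Function.Bijective α) (hγ : Function.Bijective γ) : Function.Bijective β := by
  constructor
  · refine (injective_iff_map_eq_zero β).2 fun b hb => ?_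
    have : g b = 0 := hγ.1 (by rw [← hβγ, hb, map_zero, map_zero])
    obtain ⟨a, rfl⟩ := (h.exact b).1 this
    have : a = 0 := hα.1 (h'.injective (by rw [hαβ, hb, map_zero, map_zero]))
    rw [this, map_zero]
  · intro b'
    obtain ⟨c, hc⟩ := hγ.2 (g' b')
    obtain ⟨b, rfl⟩ := h.surjective c
    obtain ⟨a', ha'⟩ := (h'.exact (b' - β b)).1 (by rw [map_sub, hβγ, hc, sub_self])
    obtain ⟨a, rfl⟩ := hα.2 a'
    exact ⟨f a + b, by rw [map_add, ← hαβ, ha', sub_add_cancel]⟩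

theorem bijective_right (h : IsShortExact f g) (h' : IsShortExact f' g')
    (α : A →ₗ[R] A') (β : B →ₗ[R] B') (γ : C →ₗ[R] C')
    (hαβ : ∀ a, f' (α a) = β (f a)) (hβγ : ∀ b, g' (β b) = γ (g b))
    (hα : Function.Bijective α) (hβ : Function.Bijective β) : Function.Bijective γ := by
  constructor
  · refine (injective_iff_map_eq_zero γ).2 fun c hc => ?_
    obtain ⟨b, rfl⟩ := h.surjective c
    obtain ⟨a', ha'⟩ := (h'.exact (β b)).1 (by rw [hβγ, hc])
    obtain ⟨a, rfl⟩ := hα.2 a'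
    rw [hαβ] at ha'
    exact (h.exact b).2 ⟨a, hβ.1 ha'⟩
  · intro c'
    obtain ⟨b', rfl⟩ := h'.surjective c'
    obtain ⟨b, rfl⟩ := hβ.2 b'
    exact ⟨g b, (hβγ b).symm⟩

end Linear

end IsShortExact

/-! ### Pushouts of modules -/

section Pushout

variable {A B C D E : Type u} [AddCommGroup A] [AddCommGroup B] [AddCommGroup C] [AddCommGroup D]
  [AddCommGroup E] [Module R A] [Module R B] [Module R C] [Module R D] [Module R E]

/-- The pushout of `f : A → B` and `p : A → D`: the quotient of `B × D` by all `(f a, -p a)`. -/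
abbrev Pushout (f : A →ₗ[R] B) (p : A →ₗ[R] D) : Type u :=
  (B × D) ⧸ LinearMap.range (f.prod (-p))

namespace Pushout

variable (f : A →ₗ[R] B) (p : A →ₗ[R] D)

/-- The canonical map `B → B ⊔_A D`. -/
def inl : B →ₗ[R] Pushout f p :=
  (LinearMap.range (f.prod (-p))).mkQ ∘ₗ LinearMap.inl R B D

/-- The canonical map `D → B ⊔_A D`. -/
def inr : D →ₗ[R] Pushout f p :=
  (LinearMap.range (f.prod (-p))).mkQ ∘ₗ LinearMap.inr R B D

variable {f p}

theorem inl_add_inr_eq_zero {b : B} {d : D} :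
    inl f p b + inr f p d = 0 ↔ ∃ a, f a = b ∧ p a = -d := by
  have : inl f p b + inr f p d = (LinearMap.range (f.prod (-p))).mkQ (b, d) := by
    simp only [inl, inr, LinearMap.comp_apply, ← map_add, LinearMap.inl_apply,
      LinearMap.inr_apply, Prod.mk_add_mk, add_zero, zero_add]
  simp [this, neg_eq_iff_eq_neg]

theorem inl_apply_map (a : A) : inl f p (f a) = inr f p (p a) := by
  have : inl f p (f a) + inr f p (-p a) = 0 := inl_add_inr_eq_zero.2 ⟨a, rfl, by simp⟩
  rwa [map_neg, ← sub_eq_add_neg, sub_eq_zero] at this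

theorem inl_eq_zero {b : B} : inl f p b = 0 ↔ ∃ a, f a = b ∧ p a = 0 := by
  simpa using inl_add_inr_eq_zero (f := f) (p := p) (b := b) (d := 0)

theorem inr_eq_zero {d : D} : inr f p d = 0 ↔ ∃ a, f a = 0 ∧ p a = -d := by
  simpa using inl_add_inr_eq_zero (f := f) (p := p) (b := 0) (d := d)

theorem exists_eq_add (w : Pushout f p) : ∃ b d, w = inl f p b + inr f p d := by
  obtain ⟨⟨b, d⟩, rfl⟩ := Submodule.mkQ_surjective _ w
  refine ⟨b, d, ?_⟩
  simp only [inl, inr, LinearMap.comp_apply, ← map_add, LinearMap.inl_apply,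
    LinearMap.inr_apply, Prod.mk_add_mk, add_zero, zero_add]

/-- The map `B ⊔_A D → E` induced by maps `B → E` and `D → E` that agree on `A`. -/
def desc (φ : B →ₗ[R] E) (ψ : D →ₗ[R] E) (hφψ : ∀ a, φ (f a) = ψ (p a)) : Pushout f p →ₗ[R] E :=
  (LinearMap.range (f.prod (-p))).liftQ (φ.coprod ψ) (by
    rintro _ ⟨a, rfl⟩
    simp [hφψ])

section desc

variable (φ : B →ₗ[R] E) (ψ : D →ₗ[R] E) (hφψ : ∀ a, φ (f a) = ψ (p a))

@[simp]
theorem desc_inl (b : B) : desc φ ψ hφψ (inl f p b) = φ b := by simp [desc, inl]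

@[simp]
theorem desc_inr (d : D) : desc φ ψ hφψ (inr f p d) = ψ d := by simp [desc, inr]

end desc

/-- The pushout of a short exact sequence `0 → A → B → C → 0` along `p : A → D`. -/
theorem isShortExact_inr {g : B →ₗ[R] C} (h : IsShortExact f g) (p : A →ₗ[R] D) :
    IsShortExact (inr f p)
      (desc g (0 : D →ₗ[R] C) fun a => by simp [h.exact.apply_apply_eq_zero]) := by
  refine ⟨(injective_iff_map_eq_zero _).2 fun d hd => ?_, fun w => ?_, fun c => ?_⟩
  · obtain ⟨a, ha, had⟩ := inr_eq_zero.1 hd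
    rw [(injective_iff_map_eq_zero f).1 h.injective a ha, map_zero] at had
    exact neg_eq_zero.1 had.symm
  · obtain ⟨b, d, rfl⟩ := exists_eq_add w
    simp only [map_add, desc_inl, desc_inr, LinearMap.zero_apply, add_zero]
    constructor
    · intro hb
      obtain ⟨a, rfl⟩ := (h.exact b).1 hb
      exact ⟨p a + d, by rw [map_add, inl_apply_map]⟩
    · rintro ⟨d', hd'⟩
      simpa using congrArg (desc g (0 : D →ₗ[R] C) fun a => by
        simp [h.exact.apply_apply_eq_zero]) hd'.symm
  · obtain ⟨b, rfl⟩ := h.surjective c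
    exact ⟨inl f p b, desc_inl _ _ _ b⟩

/-- The pushout of a short exact sequence `0 → A → D → E → 0` along `f : A → B`. -/
theorem isShortExact_inl {q : D →ₗ[R] E} (h : IsShortExact p q) (f : A →ₗ[R] B) :
    IsShortExact (inl f p)
      (desc (0 : B →ₗ[R] E) q fun a => by simp [h.exact.apply_apply_eq_zero]) := by
  refine ⟨(injective_iff_map_eq_zero _).2 fun b hb => ?_, fun w => ?_, fun e => ?_⟩
  · obtain ⟨a, rfl, ha⟩ := inl_eq_zero.1 hb
    rw [(injective_iff_map_eq_zero p).1 h.injective a ha, map_zero]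
  · obtain ⟨b, d, rfl⟩ := exists_eq_add w
    simp only [map_add, desc_inl, desc_inr, LinearMap.zero_apply, zero_add]
    constructor
    · intro hd
      obtain ⟨a, rfl⟩ := (h.exact d).1 hd
      exact ⟨b + f a, by rw [map_add, inl_apply_map]⟩
    · rintro ⟨b', hb'⟩
      simpa using congrArg (desc (0 : B →ₗ[R] E) q fun a => by
        simp [h.exact.apply_apply_eq_zero]) hb'.symm
  · obtain ⟨d, rfl⟩ := h.surjective e
    exact ⟨inr f p d, desc_inr _ _ _ d⟩

/-- If `p : A → D` is surjective with kernel `C`, then `B → B ⊔_A D` is surjective with the same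
kernel. -/
theorem isShortExact_comp_inl {k : C →ₗ[R] A} (h : IsShortExact k p)
    (hf : Function.Injective f) : IsShortExact (f ∘ₗ k) (inl f p) := by
  refine ⟨hf.comp h.injective, fun b => ?_, fun w => ?_⟩
  · rw [inl_eq_zero]
    constructor
    · rintro ⟨a, rfl, ha⟩
      obtain ⟨c, rfl⟩ := (h.exact a).1 ha
      exact ⟨c, rfl⟩
    · rintro ⟨c, rfl⟩
      exact ⟨k c, rfl, h.exact.apply_apply_eq_zero c⟩
  · obtain ⟨b, d, rfl⟩ := exists_eq_add w
    obtain ⟨a, rfl⟩ := h.surjective d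
    exact ⟨b + f a, by rw [map_add, inl_apply_map]⟩

end Pushout

end Pushout

/-! ### Totally reflexive modules -/

section TotallyReflexive

open Module

namespace IsShortExact

variable {A B C : ModuleCat.{u} R} {f : A →ₗ[R] B} {g : B →ₗ[R] C}

theorem dual (h : IsShortExact f g)
    (hC : Subsingleton (Abelian.Ext C (ModuleCat.of R R) 1)) :
    IsShortExact (A := ModuleCat.of R (Dual R C)) (B := ModuleCat.of R (Dual R B))
      (C := ModuleCat.of R (Dual R A)) g.dualMap f.dualMap :=
  ⟨LinearMap.dualMap_injective_of_surjective h.surjective,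
    LinearMap.exact_lcomp_of_exact_of_surjective R h.exact h.surjective,
    h.exists_extension (ModuleCat.of R R) hC⟩

theorem bidual (h : IsShortExact f g)
    (hC : Subsingleton (Abelian.Ext C (ModuleCat.of R R) 1))
    (hA : Subsingleton (Abelian.Ext (ModuleCat.of R (Dual R A)) (ModuleCat.of R R) 1)) :
    IsShortExact (A := Dual R (Dual R A)) (B := Dual R (Dual R B)) (C := Dual R (Dual R C))
      f.dualMap.dualMap g.dualMap.dualMap :=
  IsShortExact.dual (A := ModuleCat.of R (Dual R C)) (B := ModuleCat.of R (Dual R B))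
    (C := ModuleCat.of R (Dual R A)) (h.dual hC) hA

end IsShortExact

theorem subsingleton_ext_of_projective (P Y : ModuleCat.{u} R) [Module.Projective R P] (i : ℕ)
    (hi : 1 ≤ i) : Subsingleton (Abelian.Ext P Y i) := by
  obtain ⟨i, rfl⟩ := Nat.exists_eq_add_of_le' hi
  have : CategoryTheory.Projective P := (IsProjective.iff_projective (R := R) P).1 inferInstance
  exact Abelian.Ext.subsingleton_of_projective P Y i

theorem IsTotallyReflexive.of_projective (P : ModuleCat.{u} R) [Module.Finite R P]
    [Module.Projective R P] : IsTotallyReflexive P where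
  finite := inferInstance
  reflexive := inferInstance
  ext_eq_zero := subsingleton_ext_of_projective P _
  ext_dual_eq_zero :=
    have : Module.Projective R (ModuleCat.of R (Dual R P)) := dual_projective
    subsingleton_ext_of_projective _ _

/-- Totally reflexive modules are closed under extensions. -/
theorem IsTotallyReflexive.of_isShortExact {A B C : ModuleCat.{u} R} {f : A →ₗ[R] B}
    {g : B →ₗ[R] C} (h : IsShortExact f g) (hA : IsTotallyReflexive A)
    (hC : IsTotallyReflexive C) : IsTotallyReflexive B where
  finite :=
    have := hA.finite
    have := hC.finite
    Module.Finite.of_exact h.exact h.surjective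
  reflexive := ⟨h.bijective_middle
    (h.bidual (hC.ext_eq_zero 1 le_rfl) (hA.ext_dual_eq_zero 1 le_rfl))
    (Dual.eval R A) (Dual.eval R B) (Dual.eval R C) (fun _ => rfl) (fun _ => rfl)
    hA.reflexive.1 hC.reflexive.1⟩
  ext_eq_zero i hi :=
    h.subsingleton_ext_middle_contravariant _ i (hA.ext_eq_zero i hi) (hC.ext_eq_zero i hi)
  ext_dual_eq_zero i hi :=
    (h.dual (hC.ext_eq_zero 1 le_rfl)).subsingleton_ext_middle_contravariant _ i
      (hC.ext_dual_eq_zero i hi) (hA.ext_dual_eq_zero i hi)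

/-- The cokernel of an embedding `f` of a totally reflexive module into a finitely generated
projective module is totally reflexive if the dual of `f` is surjective. -/
theorem IsTotallyReflexive.of_isShortExact_of_projective {A B C : ModuleCat.{u} R}
    {f : A →ₗ[R] B} {g : B →ₗ[R] C} (h : IsShortExact f g) (hA : IsTotallyReflexive A)
    [Module.Finite R B] [Module.Projective R B] (hf : Function.Surjective f.dualMap) :
    IsTotallyReflexive C := by
  have hB : IsTotallyReflexive B := .of_projective B
  have hC : Subsingleton (Abelian.Ext C (ModuleCat.of R R) 1) :=
    h.subsingleton_ext_one_right (ModuleCat.of R R) hf (hB.ext_eq_zero 1 le_rfl)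
  refine ⟨Module.Finite.of_surjective g h.surjective, ⟨?_⟩, fun i hi => ?_, fun i hi => ?_⟩
  · exact h.bijective_right (h.bidual hC (hA.ext_dual_eq_zero 1 le_rfl)) (Dual.eval R A)
      (Dual.eval R B) (Dual.eval R C) (fun _ => rfl) (fun _ => rfl) hA.reflexive.1 hB.reflexive.1
  · obtain rfl | ⟨i, rfl⟩ : i = 1 ∨ ∃ j, i = j + 1 + 1 := by
      obtain ⟨_ | j, rfl⟩ := Nat.exists_eq_add_of_le' hi
      exacts [.inl rfl, .inr ⟨j, rfl⟩]
    · exact hC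
    · exact h.subsingleton_ext_right_contravariant _ _ (hA.ext_eq_zero _ (by lia))
        (hB.ext_eq_zero _ (by lia))
  · exact (h.dual hC).subsingleton_ext_left_contravariant _ i (hB.ext_dual_eq_zero i hi)
      (hA.ext_dual_eq_zero _ (by lia))

/-- Every totally reflexive module `X` over a Noetherian ring is the first syzygy of a totally
reflexive module: finitely many generators of `X^*` are the coordinates of an embedding of `X`
into a free module, and its cokernel is totally reflexive. -/
theorem IsTotallyReflexive.exists_cosyzygy [IsNoetherianRing R] {X : ModuleCat.{u} R}
    (hX : IsTotallyReflexive X) :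
    ∃ (n : ℕ) (Y : ModuleCat.{u} R) (f : X →ₗ[R] (Fin n → R)) (g : (Fin n → R) →ₗ[R] Y),
      IsShortExact f g ∧ IsTotallyReflexive Y := by
  have := hX.finite
  have : Module.Finite R (Dual R X) :=
    have : IsNoetherian R (X →ₗ[R] R) := isNoetherian_linearMap R R X
    IsNoetherian.finite R _
  obtain ⟨n, s, hs⟩ := Module.Finite.exists_fin (R := R) (M := Dual R X)
  have hdual : Function.Surjective (LinearMap.pi s).dualMap := by
    rw [← LinearMap.range_eq_top, eq_top_iff, ← hs, Submodule.span_le]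
    rintro _ ⟨i, rfl⟩
    exact ⟨LinearMap.proj i, rfl⟩
  have hinj : Function.Injective (LinearMap.pi s) := by
    refine fun x y hxy => hX.reflexive.1.1 (LinearMap.ext fun φ => ?_)
    obtain ⟨ψ, rfl⟩ := hdual φ
    exact congrArg ψ hxy
  let F : ModuleCat.{u} R := ModuleCat.of R (Fin n → R)
  have h := IsShortExact.of_range hinj
  exact ⟨n, ModuleCat.of R ((Fin n → R) ⧸ LinearMap.range (LinearMap.pi s)), _, _, h,
    .of_isShortExact_of_projective (B := F)
      (C := ModuleCat.of R ((Fin n → R) ⧸ LinearMap.range (LinearMap.pi s))) h hX hdual⟩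

end TotallyReflexive

/-! ### Finite projective hulls of modules of finite Gorenstein dimension -/

theorem IsShortExact.hasProjectiveDimensionLE_right {A B C : ModuleCat.{u} R} {f : A →ₗ[R] B}
    {g : B →ₗ[R] C} (h : IsShortExact f g) (n : ℕ) (hA : HasProjectiveDimensionLE A n)
    [Module.Projective R B] : HasProjectiveDimensionLE C (n + 1) :=
  have : Projective B := (IsProjective.iff_projective (R := R) B).1 inferInstance
  (h.shortExact.hasProjectiveDimensionLT_X₃_iff n this).2 hA

theorem IsShortExact.hasProjectiveDimensionLE_left {A B C : ModuleCat.{u} R} {f : A →ₗ[R] B}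
    {g : B →ₗ[R] C} (h : IsShortExact f g) (n : ℕ) (hC : HasProjectiveDimensionLE C (n + 1))
    [Module.Projective R B] : HasProjectiveDimensionLE A n :=
  have : Projective B := (IsProjective.iff_projective (R := R) B).1 inferInstance
  (h.shortExact.hasProjectiveDimensionLT_X₃_iff n this).1 hC

/-- A module `N` of Gorenstein dimension at most `n` embeds into a module `P` of projective
dimension at most `n` with totally reflexive cokernel. -/
theorem HasGResolution.exists_hull [IsNoetherianRing R] {n : ℕ} {N : ModuleCat.{u} R}
    (hN : HasGResolution n N) :
    ∃ (P X : ModuleCat.{u} R) (f : N →ₗ[R] P) (g : P →ₗ[R] X),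
      IsShortExact f g ∧ IsTotallyReflexive X ∧ HasProjectiveDimensionLE P n := by
  induction hN with
  | zero X M hX e =>
    obtain ⟨n, Y, f, g, h, hY⟩ := hX.exists_cosyzygy
    have : Projective (ModuleCat.of R (Fin n → R)) :=
      (IsProjective.iff_projective (R := R) (Fin n → R)).1 inferInstance
    exact ⟨ModuleCat.of R (Fin n → R), Y, _, _, h.comp_linearEquiv e.symm, hY, inferInstance⟩
  | succ n N X M f g hf hfg hg hX hN ih =>
    have h : IsShortExact f g := ⟨hf, hfg, hg⟩
    obtain ⟨P, Y, p, q, hpq, hY, hP⟩ := ih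
    -- The pushout `W` of `X` and `P` over `N` sits in `0 → P → W → M → 0`, and it is totally
    -- reflexive, as an extension of `Y` by `X`.
    let W : ModuleCat.{u} R := ModuleCat.of R (Pushout f p)
    have hPW := Pushout.isShortExact_inr h p
    have hW : IsTotallyReflexive W :=
      .of_isShortExact (B := W) (Pushout.isShortExact_inl hpq f) hX hY
    -- Embedding `W` into a free module `F` makes `M = W / P` a submodule of `F / P`.
    obtain ⟨k, Z, s, t, hst, hZ⟩ := hW.exists_cosyzygy
    have hPF := Pushout.isShortExact_comp_inl hPW hst.injective
    have : Module.Projective R (ModuleCat.of R (Fin k → R)) :=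
      inferInstanceAs (Module.Projective R (Fin k → R))
    exact ⟨ModuleCat.of R (Pushout s _), Z, _, _, Pushout.isShortExact_inr hst _, hZ,
      IsShortExact.hasProjectiveDimensionLE_right (B := ModuleCat.of R (Fin k → R))
        (C := ModuleCat.of R (Pushout s _)) hPF n hP⟩

/-- A finitely generated module of projective dimension at most `n` over a Noetherian ring has
Gorenstein dimension at most `n`. -/
theorem HasGResolution.of_hasProjectiveDimensionLE [IsNoetherianRing R] (n : ℕ)
    (N : ModuleCat.{u} R) [Module.Finite R N] (hN : HasProjectiveDimensionLE N n) :
    HasGResolution n N := by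
  induction n generalizing N with
  | zero =>
    have : Module.Projective R N := (IsProjective.iff_projective (R := R) N).2
      ((projective_iff_hasProjectiveDimensionLE_zero _).2 hN)
    exact .zero N N (.of_projective N) (.refl R N)
  | succ n ih =>
    obtain ⟨k, g, hg⟩ := Module.Finite.exists_fin' R N
    have h := IsShortExact.of_ker hg
    have : Module.Projective R (ModuleCat.of R (Fin k → R)) :=
      inferInstanceAs (Module.Projective R (Fin k → R))
    have : Module.Finite R (ModuleCat.of R (Fin k → R)) :=
      inferInstanceAs (Module.Finite R (Fin k → R))
    let L : ModuleCat.{u} R := ModuleCat.of R (LinearMap.ker g)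
    have : Module.Finite R L := inferInstanceAs (Module.Finite R (LinearMap.ker g))
    exact .succ n L (ModuleCat.of R (Fin k → R)) N _ _ h.injective h.exact h.surjective
      (.of_projective _) (ih L (IsShortExact.hasProjectiveDimensionLE_left (A := L)
        (B := ModuleCat.of R (Fin k → R)) h n hN))

/-! ### Modules without extensions by totally reflexive modules -/

/-- `Ext^i(X, M) = 0` for all `i ≥ 1` and all totally reflexive modules `X`. -/
def IsRightOrthogonal (M : ModuleCat.{u} R) : Prop :=
  ∀ X : ModuleCat.{u} R, IsTotallyReflexive X → ∀ i : ℕ, 1 ≤ i → Subsingleton (Abelian.Ext X M i)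

theorem isRightOrthogonal_self : IsRightOrthogonal (ModuleCat.of R R) :=
  fun _ hX i hi => hX.ext_eq_zero i hi

namespace IsRightOrthogonal

variable {M N : ModuleCat.{u} R}

theorem of_linearEquiv (hM : IsRightOrthogonal M) (e : M ≃ₗ[R] N) : IsRightOrthogonal N := by
  refine fun X hX i hi => subsingleton_of_forall_eq 0 fun x => ?_
  have : x = (x.comp (Abelian.Ext.mk₀ (ModuleCat.ofHom e.symm.toLinearMap)) (add_zero i)).comp
      (Abelian.Ext.mk₀ (ModuleCat.ofHom e.toLinearMap)) (add_zero i) := by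
    rw [Abelian.Ext.comp_assoc_of_third_deg_zero, Abelian.Ext.mk₀_comp_mk₀, ← ModuleCat.ofHom_comp,
      LinearEquiv.comp_coe, LinearEquiv.symm_trans_self]
    exact (Abelian.Ext.comp_mk₀_id x).symm
  rw [this, (hM X hX i hi).elim (x.comp _ _) 0, Abelian.Ext.zero_comp]

theorem pi (hM : IsRightOrthogonal M) (n : ℕ) :
    IsRightOrthogonal (ModuleCat.of R (Fin n → M)) := by
  refine fun X hX i hi => subsingleton_of_forall_eq 0 fun x => ?_
  have hid : 𝟙 (ModuleCat.of R (Fin n → M)) = ∑ j : Fin n,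
      ModuleCat.ofHom (LinearMap.proj j) ≫ (ModuleCat.ofHom (LinearMap.single R (fun _ => M) j) :
        M ⟶ ModuleCat.of R (Fin n → M)) := by
    ext x
    simp
  rw [← Abelian.Ext.comp_mk₀_id x, hid, Abelian.Ext.mk₀_sum, Abelian.Ext.comp_sum]
  refine Finset.sum_eq_zero fun j _ => ?_
  rw [← Abelian.Ext.mk₀_comp_mk₀, ← Abelian.Ext.comp_assoc_of_third_deg_zero,
    (hM X hX i hi).elim (x.comp _ _) 0, Abelian.Ext.zero_comp]

theorem of_isShortExact {A B C : ModuleCat.{u} R} {f : A →ₗ[R] B} {g : B →ₗ[R] C}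
    (h : IsShortExact f g) (hA : IsRightOrthogonal A) (hC : IsRightOrthogonal C) :
    IsRightOrthogonal B :=
  fun X hX i hi => h.subsingleton_ext_middle X i (hA X hX i hi) (hC X hX i hi)

/-- The right orthogonal of the totally reflexive modules is closed under kernels of surjections.
For `Ext¹(X, -)` this holds because `X` is itself a syzygy of a totally reflexive module. -/
theorem left_of_isShortExact [IsNoetherianRing R] {A B C : ModuleCat.{u} R} {f : A →ₗ[R] B}
    {g : B →ₗ[R] C} (h : IsShortExact f g) (hB : IsRightOrthogonal B)
    (hC : IsRightOrthogonal C) : IsRightOrthogonal A := by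
  have key : ∀ X : ModuleCat.{u} R, IsTotallyReflexive X → ∀ i : ℕ, 1 ≤ i →
      Subsingleton (Abelian.Ext X A (i + 1)) := fun X hX i hi =>
    h.subsingleton_ext_left X i (hC X hX i hi) (hB X hX (i + 1) (by lia))
  intro X hX i hi
  obtain ⟨n, Y, s, t, hst, hY⟩ := hX.exists_cosyzygy
  have : Module.Projective R (ModuleCat.of R (Fin n → R)) :=
    inferInstanceAs (Module.Projective R (Fin n → R))
  exact IsShortExact.subsingleton_ext_left_contravariant (B := ModuleCat.of R (Fin n → R)) hst A i
    (subsingleton_ext_of_projective _ A i hi) (key Y hY i hi)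

theorem of_isSyzygy [IsLocalRing R] [IsNoetherianRing R] {n : ℕ} (hM : IsRightOrthogonal M)
    (h : IsSyzygy n M N) : IsRightOrthogonal N := by
  induction h with
  | zero M N e => exact hM.of_linearEquiv e
  | succ n k M L N f g hf hfg hg _ _ ih =>
    exact ih (left_of_isShortExact (B := ModuleCat.of R (Fin k → R)) ⟨hf, hfg, hg⟩
      (isRightOrthogonal_self.pi k) hM)

/-- A module of finite Gorenstein dimension in the right orthogonal of the totally reflexive
modules is a direct summand of its finite projective hull. -/
theorem hasProjectiveDimensionLE [IsNoetherianRing R] (hM : IsRightOrthogonal M) {n : ℕ}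
    (h : HasGResolution n M) : HasProjectiveDimensionLE M n := by
  obtain ⟨P, X, f, g, hfg, hX, hP⟩ := h.exists_hull
  obtain ⟨r, hr⟩ := hfg.exists_extension M (hM X hX 1 le_rfl) LinearMap.id
  have hret : Retract M P :=
    { i := ModuleCat.ofHom f, r := ModuleCat.ofHom r, retract := ModuleCat.hom_ext hr }
  exact hret.hasProjectiveDimensionLT (n + 1)

end IsRightOrthogonal

/-! ### Reducing sequences -/

/-- The zero module needs a case of its own, since its Gorenstein dimension is `⊥` by definition. -/
theorem gorensteinDimension_lt_top_iff (M : ModuleCat.{u} R) :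
    gorensteinDimension M < ⊤ ↔ Subsingleton M ∨ ∃ n, HasGResolution n M := by
  unfold gorensteinDimension
  split_ifs with h
  · simp [h]
  · simp only [h, false_or]
    constructor
    · intro hlt
      obtain ⟨_, ⟨n, hn, rfl⟩, -⟩ := sInf_lt_iff.1 hlt
      exact ⟨n, hn⟩
    · rintro ⟨n, hn⟩
      exact sInf_lt_iff.2 ⟨_, ⟨n, hn, rfl⟩, WithBot.coe_lt_coe.2 (ENat.natCast_lt_top n)⟩

/-- The steps of a reducing sequence do not involve the invariant, so only the condition on the
last term has to be transferred from `H` to `H'`. -/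
theorem reducingInvariant_le_of_forall [IsLocalRing R] {H H' : ModuleCat.{u} R → WithBot ℕ∞}
    {M : ModuleCat.{u} R}
    (h : ∀ (r : ℕ) (K : Fin (r + 1) → ModuleCat.{u} R), IsReducingSequence H M r K →
      H' (K (Fin.last r)) < ⊤) :
    reducingInvariant H' M ≤ reducingInvariant H M := by
  refine sInf_le_sInf ?_
  rintro _ ⟨r, K, hK, rfl⟩
  exact ⟨r, K, ⟨hK.head, hK.step, h r K hK⟩, rfl⟩

theorem IsSyzygy.finite [IsLocalRing R] [IsNoetherianRing R] {n : ℕ} {M N : ModuleCat.{u} R}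
    (h : IsSyzygy n M N) (hM : Module.Finite R M) : Module.Finite R N := by
  induction h with
  | zero M N e => exact Module.Finite.equiv e
  | succ n k M L N f g hf hfg hg _ _ ih => exact ih (Module.Finite.of_injective f hf)

variable [IsLocalRing R] [IsNoetherianRing R] {H : ModuleCat.{u} R → WithBot ℕ∞}
  {M : ModuleCat.{u} R} {r : ℕ} {K : Fin (r + 1) → ModuleCat.{u} R}

theorem IsReducingSequence.finite (hK : IsReducingSequence H M r K) (hM : Module.Finite R M)
    (i : Fin (r + 1)) : Module.Finite R (K i) := by
  induction i using Fin.induction with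
  | zero => rwa [hK.head]
  | succ i ih =>
    obtain ⟨a, b, n, -, -, -, S, hS, f, g, -, hfg, hg⟩ := hK.step i
    have := hS.finite ih
    exact Module.Finite.of_exact hfg hg

theorem IsReducingSequence.isRightOrthogonal (hK : IsReducingSequence H M r K)
    (hM : IsRightOrthogonal M) (i : Fin (r + 1)) : IsRightOrthogonal (K i) := by
  induction i using Fin.induction with
  | zero => rwa [hK.head]
  | succ i ih =>
    obtain ⟨a, b, n, -, -, -, S, hS, f, g, hf, hfg, hg⟩ := hK.step i
    exact .of_isShortExact (A := ModuleCat.of R (Fin a → K i.castSucc))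
      (C := ModuleCat.of R (Fin b → S)) ⟨hf, hfg, hg⟩ (ih.pi a) ((ih.of_isSyzygy hS).pi b)

theorem reducingGdim_le_reducingPdim (M : ModuleCat.{u} R) [Module.Finite R M] :
    reducingGdim M ≤ reducingPdim M := by
  refine reducingInvariant_le_of_forall fun r K hK => ?_
  obtain ⟨n, hn⟩ := (projectiveDimension_ne_top_iff _).1 hK.last.ne
  have := hK.finite inferInstance (Fin.last r)
  exact (gorensteinDimension_lt_top_iff _).2 (.inr ⟨n, .of_hasProjectiveDimensionLE n _ hn⟩)

theorem reducingPdim_le_reducingGdim {M : ModuleCat.{u} R} (hM : IsRightOrthogonal M) :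
    reducingPdim M ≤ reducingGdim M := by
  refine reducingInvariant_le_of_forall fun r K hK => ?_
  obtain h | ⟨n, hn⟩ := (gorensteinDimension_lt_top_iff _).1 hK.last
  · rw [(projectiveDimension_eq_bot_iff _).2 (ModuleCat.isZero_of_subsingleton _)]
    exact bot_lt_top
  · exact ((projectiveDimension_ne_top_iff _).2
      ⟨n, (hK.isRightOrthogonal hM _).hasProjectiveDimensionLE hn⟩).lt_top

end ReducingDimension

theorem proposition2p6 {R : Type u} [CommRing R] [IsLocalRing R] [IsNoetherianRing R]
    (M : Type u) [AddCommGroup M] [Module R M] [Module.Finite R M]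
    (hM : ∀ X : ModuleCat.{u} R, ReducingDimension.IsTotallyReflexive X →
      ∀ i : ℕ, 1 ≤ i → Subsingleton (Abelian.Ext X (ModuleCat.of R M) i)) :
    ReducingDimension.reducingGdim (ModuleCat.of R M) =
      ReducingDimension.reducingPdim (ModuleCat.of R M) := by
  exact le_antisymm (ReducingDimension.reducingGdim_le_reducingPdim _)
    (ReducingDimension.reducingPdim_le_reducingGdim hM)
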